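/- Let $\alpha_1<\cdots<\alpha_m$ be real numbers ($m\ge 1$) and $\mathcal A=\{\alpha_1,\dots,\alpha_m\}$. For $\beta\in\mathcal A$ let $C_{[0,\infty)}(\mathcal A,\beta)$ be the set of functions $f(x)=\sum_{\alpha\in\mathcal A}c_\alpha\exp(\alpha x)$ on $\mathbb R$ with real coefficients $c_\alpha$ such that $f(x)\ge 0$ for all $x\ge 0$ and $c_\alpha\ge 0$ for all $\alpha\in\mathcal A\setminus\{\beta\}$, and let $C_{[0,\infty)}(\mathcal A)=\sum_{\beta\in\mathcal A}C_{[0,\infty)}(\mathcal A,\beta)$ (Minkowski sum). The extreme rays of a pointed convex cone are its faces of dimension one; here a face of a convex set $S$ is a closed convex subset $F\subset S$ that contains every segment in $S$ whose relative interior meets $F$. Write $\mathbb R_+=[0,\infty)$. Then the extreme rays of $C_{[0,\infty)}(\mathcal A)$ are exactly the following: 1. $\mathbb R_+\cdot\exp(\alpha_1x)$; 2. if $m\ge 2$, $\mathbb R_+\cdot\big(\exp(\alpha_2x)-\exp(\alpha_1x)\big)$; 3. for each $i$ with $2\le i\le m-1$, the rays $$\mathbb R_+\cdot\big(c_{i+1}\exp(\alpha_{i+1}x)+c_i\exp(\alpha_ix)+c_{i-1}\exp(\alpha_{i-1}x)\big)$$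 with $$c_{i+1}>0,\qquad c_{i-1}>0,\qquad c_i=-\left(\frac{c_{i-1}}{\lambda_{i-1}}\right)^{\lambda_{i-1}}\left(\frac{c_{i+1}}{\lambda_{i+1}}\right)^{\lambda_{i+1}},\qquad \frac{c_{i-1}}{c_{i+1}}\ge\frac{\lambda_{i-1}}{\lambda_{i+1}},$$ where $$\lambda_{i+1}=\frac{\alpha_i-\alpha_{i-1}}{\alpha_{i+1}-\alpha_{i-1}},\qquad \lambda_{i-1}=\frac{\alpha_{i+1}-\alpha_i}{\alpha_{i+1}-\alpha_{i-1}}.$$ -/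

import Mathlib

open scoped Pointwise

/-- The signomial `x ↦ ∑_{a ∈ A} c_a exp (a x)` in one real variable, with exponent set `A` and
coefficients `c` (only the values of `c` on `A` matter). -/
noncomputable def signomial (A : Finset ℝ) (c : ℝ → ℝ) : ℝ → ℝ :=
  fun x => ∑ a ∈ A, c a * Real.exp (a * x)

/-- The cone of `X`-AGE functions `C_X(A, β)`: the signomials supported on `A` that are nonnegative
on `X` and whose coefficients, except possibly the one at `β`, are nonnegative. -/
def ageCone (X : Set ℝ) (A : Finset ℝ) (β : ℝ) : Set (ℝ → ℝ) :=
  {f | ∃ c : ℝ → ℝ, f = signomial A c ∧ (∀ x ∈ X, 0 ≤ f x) ∧ ∀ a ∈ A, a ≠ β → 0 ≤ c a}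

/-- The `X`-SAGE cone `C_X(A)`: the Minkowski sum of the cones `C_X(A, β)` over `β ∈ A`. -/
def sageCone (X : Set ℝ) (A : Finset ℝ) : Set (ℝ → ℝ) :=
  ∑ β ∈ A, ageCone X A β

/-- `F` is a face of the convex set `S`: a closed convex subset of `S` that contains every segment
in `S` whose relative interior meets `F`. -/
structure IsFace {E : Type*} [AddCommGroup E] [Module ℝ E] [TopologicalSpace E]
    (S F : Set E) : Prop where
  isClosed : IsClosed F
  convex : Convex ℝ F
  isExtreme : IsExtreme ℝ S F

/-- The extreme rays of a pointed convex cone `K`: its faces of dimension one, the dimension being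
that of the affine hull. -/
def extremeRays {E : Type*} [AddCommGroup E] [Module ℝ E] [TopologicalSpace E]
    (K : Set E) : Set (Set E) :=
  {F | IsFace K F ∧ Module.finrank ℝ (vectorSpan ℝ F) = 1}

/-- The ray `ℝ₊ · v`. -/
def ray {E : Type*} [AddCommGroup E] [Module ℝ E] (v : E) : Set E :=
  {w | ∃ t : ℝ, 0 ≤ t ∧ w = t • v}

/-!
The extreme rays of the univariate SAGE cone on `[0, ∞)` are those spanned by the lowest exponential
`exp (p x)`, by the binomial `exp (q x) - exp (p x)` of the two lowest exponents, and by the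
circuits: trinomials on three consecutive exponents `p < q < r` with a double zero at some
`x₀ ≥ 0`. Parametrizing a circuit by `x₀` rather than by its coefficients makes both directions
elementary; `exists_ray_circuit_iff` translates between the two descriptions.

Both directions rest on one observation. After division by `exp (β x)`, a signomial whose
coefficients are nonnegative off `β` is convex, so with a zero at `x₀ ≥ 0` it is nonnegative on
`[0, ∞)` exactly when its derivative `D` at `x₀` satisfies `0 ≤ (x - x₀) * D` for all `x ≥ 0`
(`sub_mul_deriv_nonneg`, `signomial_nonneg_of_tangent`).

*Every extreme ray is listed* (`exists_of_mem_extremeRays`). An extreme ray is spanned by a single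
AGE function `f`, and everything that can be split off `f` within the cone spans the same ray. If
`f` has no negative coefficient, an exponential splits off. If its coefficient at `β` is negative,
`f` has a zero `x₀ ≥ 0`, since otherwise a multiple of `exp (β x)` would split off. A zero with
positive slope must be `x₀ = 0`, and then a binomial splits off by the tangent criterion; at a
double zero a circuit does. The exponents involved must be consecutive, because binomials and
circuits with gaps decompose further (`binomial_split`, `circuit_split_left`,
`circuit_split_right`).

*Every listed ray is extreme* (`exp_mem_extremeRays`, `binomial_mem_extremeRays`,
`circuit_mem_extremeRays`). In a decomposition within the cone leading coefficients are
nonnegative, so no exponent above those of the generator occurs. For a circuit the double zero is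
inherited by all AGE summands, which forces their lowest coefficients to be nonnegative too
(`lowest_coeff_nonneg_of_double_zero`). Hence the summands have the support of the generator, and
the (double) zero determines them up to scaling.
-/

/-! ### Signomials and their coefficients -/

lemma signomial_add (A : Finset ℝ) (c d : ℝ → ℝ) :
    signomial A (c + d) = signomial A c + signomial A d := by
  ext x; simp [signomial, add_mul, Finset.sum_add_distrib]

lemma signomial_sub (A : Finset ℝ) (c d : ℝ → ℝ) :
    signomial A (c - d) = signomial A c - signomial A d := by
  ext x; simp [signomial, sub_mul, Finset.sum_sub_distrib]

lemma signomial_smul (A : Finset ℝ) (t : ℝ) (c : ℝ → ℝ) :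
    signomial A (t • c) = t • signomial A c := by
  ext x; simp [signomial, Finset.mul_sum, mul_assoc]

lemma signomial_sum {κ : Type*} (A : Finset ℝ) (B : Finset κ) (d : κ → ℝ → ℝ) :
    signomial A (∑ k ∈ B, d k) = ∑ k ∈ B, signomial A (d k) := by
  ext x; simp [signomial, Finset.sum_mul]; exact Finset.sum_comm

lemma signomial_single {A : Finset ℝ} {p : ℝ} (hp : p ∈ A) (t x : ℝ) :
    signomial A (Pi.single p t) x = t * Real.exp (p * x) := by
  rw [signomial, Finset.sum_eq_single p]
  · simp
  · intro b _ hb; simp [hb]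
  · exact fun h => absurd hp h

/-- A signomial that is nonnegative on `[0, ∞)` has a nonnegative leading coefficient. -/
lemma coeff_nonneg_of_forall_gt_eq_zero {A : Finset ℝ} {c : ℝ → ℝ}
    (h : ∀ x, 0 ≤ x → 0 ≤ signomial A c x) {a : ℝ} (ha : a ∈ A)
    (hz : ∀ b ∈ A, a < b → c b = 0) : 0 ≤ c a := by
  have hlim : Filter.Tendsto (fun x => ∑ b ∈ A, c b * Real.exp ((b - a) * x)) Filter.atTop
      (nhds (∑ b ∈ A, if b = a then c b else 0)) := by
    refine tendsto_finsetSum _ fun b hb => ?_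
    rcases lt_trichotomy b a with hba | rfl | hba
    · rw [if_neg hba.ne]
      have h1 : Filter.Tendsto (fun x : ℝ => (b - a) * x) Filter.atTop Filter.atBot :=
        Filter.tendsto_id.const_mul_atTop_of_neg (by linarith)
      simpa using (Real.tendsto_exp_atBot.comp h1).const_mul (c b)
    · simp
    · simp [hba.ne', hz b hb hba]
  have hsum : (∑ b ∈ A, if b = a then c b else 0) = c a := by simp [ha]
  rw [hsum] at hlim
  refine ge_of_tendsto hlim ?_
  filter_upwards [Filter.eventually_ge_atTop 0] with x hx
  have : ∑ b ∈ A, c b * Real.exp ((b - a) * x) = signomial A c x * Real.exp (-(a * x)) := by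
    rw [signomial, Finset.sum_mul]
    refine Finset.sum_congr rfl fun b _ => ?_
    rw [mul_assoc, ← Real.exp_add]; ring_nf
  rw [this]
  exact mul_nonneg (h x hx) (Real.exp_pos _).le

/-- Exponentials with distinct exponents are linearly independent, already as functions on
`[0, ∞)`. -/
lemma coeff_eq_zero_of_eqOn_zero {A : Finset ℝ} {c : ℝ → ℝ}
    (h : ∀ x, 0 ≤ x → signomial A c x = 0) : ∀ a ∈ A, c a = 0 := by
  by_contra! hne
  have hS : (A.filter (fun a => c a ≠ 0)).Nonempty := by
    obtain ⟨a, ha, hca⟩ := hne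
    exact ⟨a, by simp [ha, hca]⟩
  obtain ⟨a, ha, hmax⟩ := Finset.exists_max_image _ id hS
  simp only [Finset.mem_filter, id, and_imp] at ha hmax
  have hz : ∀ b ∈ A, a < b → c b = 0 := by
    intro b hb hab
    by_contra hcb
    exact absurd (hmax b hb hcb) (not_le.2 hab)
  have h1 : 0 ≤ c a := coeff_nonneg_of_forall_gt_eq_zero (fun x hx => (h x hx).ge) ha.1 hz
  have h2 : 0 ≤ ((-1 : ℝ) • c) a := by
    refine coeff_nonneg_of_forall_gt_eq_zero (fun x hx => ?_) ha.1 fun b hb hab => ?_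
    · rw [signomial_smul]; simp [h x hx]
    · simp [hz b hb hab]
  simp only [Pi.smul_apply, smul_eq_mul] at h2
  exact ha.2 (by linarith)

lemma signomial_injOn {A : Finset ℝ} {c d : ℝ → ℝ} (h : signomial A c = signomial A d) :
    ∀ a ∈ A, c a = d a := by
  intro a ha
  have := coeff_eq_zero_of_eqOn_zero (A := A) (c := c - d)
    (fun x _ => by rw [signomial_sub, h]; simp) a ha
  simpa [sub_eq_zero] using this

/-! ### Zeros of signomials on the half-line -/

/-- The derivative of `∑ c_a exp (a x)` is the signomial with coefficients `a c_a`. -/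
lemma hasDerivAt_signomial (A : Finset ℝ) (c : ℝ → ℝ) (x : ℝ) :
    HasDerivAt (signomial A c) (signomial A (id * c) x) x := by
  unfold signomial
  refine HasDerivAt.fun_sum fun a _ => ?_
  have h : HasDerivAt (fun y : ℝ => a * y) a x := by simpa using (hasDerivAt_id x).const_mul a
  have h' := h.exp.const_mul (c a)
  have e : ((id * c : ℝ → ℝ)) a * Real.exp (a * x) = c a * (Real.exp (a * x) * a) := by
    simp only [Pi.mul_apply, id]; ring
  rwa [e]

/-- First-order necessary condition for a zero `x₀` of a function that is nonnegative on
`[0, ∞)`; it covers interior zeros (`D = 0`) and a zero at the endpoint (`D ≥ 0`) at once. -/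
lemma sub_mul_deriv_nonneg {f : ℝ → ℝ} {D x₀ : ℝ} (hf : HasDerivAt f D x₀) (hx₀ : 0 ≤ x₀)
    (h0 : f x₀ = 0) (h : ∀ x, 0 ≤ x → 0 ≤ f x) {x : ℝ} (hx : 0 ≤ x) : 0 ≤ (x - x₀) * D := by
  have hmin : IsMinOn f (Set.Ici 0) x₀ := fun y hy => by simpa [h0] using h y hy
  have hseg : segment ℝ x₀ x ⊆ Set.Ici 0 := (convex_Ici 0).segment_subset hx₀ hx
  have := hmin.localize.hasFDerivWithinAt_nonneg hf.hasFDerivAt.hasFDerivWithinAt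
    (sub_mem_posTangentConeAt_of_segment_subset hseg)
  simpa using this

/-- First-order sufficient condition for nonnegativity: divided by `exp (β x)`, a signomial whose
coefficients are nonnegative off `β` is convex, hence lies above its tangent at a zero `x₀`. -/
lemma signomial_nonneg_of_tangent {A : Finset ℝ} {c : ℝ → ℝ} {β x₀ x : ℝ}
    (hc : ∀ a ∈ A, a ≠ β → 0 ≤ c a) (h0 : signomial A c x₀ = 0)
    (hD : 0 ≤ (x - x₀) * signomial A (id * c) x₀) : 0 ≤ signomial A c x := by
  have key : ∀ a ∈ A, Real.exp (β * (x - x₀)) *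
      (c a * Real.exp (a * x₀) * (1 + (a - β) * (x - x₀))) ≤ c a * Real.exp (a * x) := by
    intro a ha
    have e : Real.exp (a * x) =
        Real.exp (β * (x - x₀)) * Real.exp (a * x₀) * Real.exp ((a - β) * (x - x₀)) := by
      rw [← Real.exp_add, ← Real.exp_add]; ring_nf
    rcases eq_or_ne a β with rfl | hne
    · rw [e]; apply le_of_eq; simp; ring
    · rw [e]
      have h1 := Real.add_one_le_exp ((a - β) * (x - x₀))
      have h2 : 0 ≤ Real.exp (β * (x - x₀)) * (c a * Real.exp (a * x₀)) := by
        have := hc a ha hne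
        positivity
      calc _ = Real.exp (β * (x - x₀)) * (c a * Real.exp (a * x₀)) *
            ((a - β) * (x - x₀) + 1) := by ring
        _ ≤ Real.exp (β * (x - x₀)) * (c a * Real.exp (a * x₀)) *
            Real.exp ((a - β) * (x - x₀)) := mul_le_mul_of_nonneg_left h1 h2
        _ = _ := by ring
  refine le_trans ?_ (Finset.sum_le_sum key)
  have : ∑ a ∈ A, Real.exp (β * (x - x₀)) *
      (c a * Real.exp (a * x₀) * (1 + (a - β) * (x - x₀))) = Real.exp (β * (x - x₀)) *
      ((1 - β * (x - x₀)) * signomial A c x₀ + (x - x₀) * signomial A (id * c) x₀) := by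
    simp only [signomial, Finset.mul_sum, ← Finset.sum_add_distrib]
    refine Finset.sum_congr rfl fun a _ => ?_
    simp; ring
  rw [this, h0]
  have := Real.exp_pos (β * (x - x₀))
  simp only [mul_zero, zero_add]
  positivity

/-- A strictly positive signomial on `[0, ∞)` dominates a multiple of `exp (β x)` there, provided
its only possibly negative coefficient is at `β` and an exponent above `β` occurs. -/
lemma exists_mul_exp_le_signomial {A : Finset ℝ} {c : ℝ → ℝ} {β b : ℝ}
    (hc : ∀ a ∈ A, a ≠ β → 0 ≤ c a) (hβ : β ∈ A) (hb : b ∈ A) (hβb : β < b) (hcb : 0 < c b)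
    (hpos : ∀ x, 0 ≤ x → 0 < signomial A c x) :
    ∃ ε > 0, ∀ x, 0 ≤ x → ε * Real.exp (β * x) ≤ signomial A c x := by
  have hcont : Continuous (fun x => signomial A c x * Real.exp (-(β * x))) := by
    unfold signomial; fun_prop
  set R : ℝ := max 0 ((1 - c β) / (c b * (b - β))) with hR
  obtain ⟨y, hy, hmin⟩ := (isCompact_Icc (a := (0 : ℝ)) (b := R)).exists_isMinOn
    ⟨0, by simp [hR]⟩ hcont.continuousOn
  have hexp : ∀ x, Real.exp (-(β * x)) * Real.exp (β * x) = 1 := fun x => by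
    rw [← Real.exp_add]; simp
  refine ⟨min 1 (signomial A c y * Real.exp (-(β * y))),
    lt_min one_pos (mul_pos (hpos y hy.1) (Real.exp_pos _)), fun x hx => ?_⟩
  suffices h : min 1 (signomial A c y * Real.exp (-(β * y))) ≤
      signomial A c x * Real.exp (-(β * x)) by
    calc _ ≤ signomial A c x * Real.exp (-(β * x)) * Real.exp (β * x) :=
          mul_le_mul_of_nonneg_right h (Real.exp_pos _).le
      _ = _ := by rw [mul_assoc, hexp, mul_one]
  rcases le_or_gt x R with hxR | hxR
  · exact (min_le_right _ _).trans (hmin ⟨hx, hxR⟩)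
  · refine (min_le_left _ _).trans ?_
    have h2 : ∑ a ∈ ({β, b} : Finset ℝ), c a * Real.exp (a * x) ≤ signomial A c x := by
      refine Finset.sum_le_sum_of_subset_of_nonneg ?_ fun a ha hab => ?_
      · intro a ha
        simp only [Finset.mem_insert, Finset.mem_singleton] at ha
        rcases ha with rfl | rfl <;> assumption
      · simp only [Finset.mem_insert, Finset.mem_singleton, not_or] at hab
        have := hc a ha hab.1
        positivity
    rw [Finset.sum_pair hβb.ne] at h2
    have h3 : (c β * Real.exp (β * x) + c b * Real.exp (b * x)) * Real.exp (-(β * x)) =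
        c β + c b * Real.exp ((b - β) * x) := by
      rw [add_mul, mul_assoc, mul_assoc, ← Real.exp_add, ← Real.exp_add]; ring_nf; simp
    have h4 := mul_le_mul_of_nonneg_right h2 (Real.exp_pos (-(β * x))).le
    rw [h3] at h4
    refine le_trans ?_ h4
    have h5 := Real.add_one_le_exp ((b - β) * x)
    have h6 : (1 - c β) / (c b * (b - β)) < x := lt_of_le_of_lt (le_max_right _ _) hxR
    rw [div_lt_iff₀ (mul_pos hcb (sub_pos.2 hβb))] at h6
    nlinarith

/-! ### The cones -/

lemma zero_mem_ageCone (X : Set ℝ) (A : Finset ℝ) (β : ℝ) : (0 : ℝ → ℝ) ∈ ageCone X A β :=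
  ⟨0, by ext; simp [signomial], by simp, by simp⟩

lemma smul_mem_ageCone {X : Set ℝ} {A : Finset ℝ} {β t : ℝ} {f : ℝ → ℝ} (ht : 0 ≤ t)
    (hf : f ∈ ageCone X A β) : t • f ∈ ageCone X A β := by
  obtain ⟨c, rfl, hc, hc'⟩ := hf
  exact ⟨t • c, (signomial_smul A t c).symm, fun x hx => mul_nonneg ht (hc x hx),
    fun a ha hab => mul_nonneg ht (hc' a ha hab)⟩

lemma mem_sageCone {X : Set ℝ} {A : Finset ℝ} {f : ℝ → ℝ} :
    f ∈ sageCone X A ↔ ∃ g : ℝ → ℝ → ℝ, (∀ β ∈ A, g β ∈ ageCone X A β) ∧ ∑ β ∈ A, g β = f := by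
  rw [sageCone, Set.mem_finsetSum]
  constructor
  · rintro ⟨g, hg, rfl⟩; exact ⟨g, fun β hβ => hg hβ, rfl⟩
  · rintro ⟨g, hg, rfl⟩; exact ⟨g, fun hβ => hg _ hβ, rfl⟩

lemma smul_mem_sageCone {X : Set ℝ} {A : Finset ℝ} {t : ℝ} {f : ℝ → ℝ} (ht : 0 ≤ t)
    (hf : f ∈ sageCone X A) : t • f ∈ sageCone X A := by
  rw [mem_sageCone] at *
  obtain ⟨u, hu, rfl⟩ := hf
  exact ⟨fun β => t • u β, fun β hβ => smul_mem_ageCone ht (hu β hβ), by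
    simp [Finset.smul_sum]⟩

lemma ageCone_subset_sageCone {X : Set ℝ} {A : Finset ℝ} {β : ℝ} (hβ : β ∈ A) :
    ageCone X A β ⊆ sageCone X A := by
  intro f hf
  refine mem_sageCone.2 ⟨Pi.single β f, fun γ _ => ?_, by simp [Finset.sum_pi_single', hβ]⟩
  rcases eq_or_ne γ β with rfl | hne
  · simpa using hf
  · simpa [hne] using zero_mem_ageCone X A γ

lemma nonneg_of_mem_sageCone {X : Set ℝ} {A : Finset ℝ} {f : ℝ → ℝ} (hf : f ∈ sageCone X A)
    {x : ℝ} (hx : x ∈ X) : 0 ≤ f x := by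
  obtain ⟨g, hg, rfl⟩ := mem_sageCone.1 hf
  rw [Finset.sum_apply]
  refine Finset.sum_nonneg fun β hβ => ?_
  obtain ⟨c, -, h, -⟩ := hg β hβ
  exact h x hx

lemma exists_signomial_of_mem_sageCone {X : Set ℝ} {A : Finset ℝ} {f : ℝ → ℝ}
    (hf : f ∈ sageCone X A) : ∃ c, f = signomial A c := by
  obtain ⟨g, hg, rfl⟩ := mem_sageCone.1 hf
  choose! c hc using hg
  exact ⟨∑ β ∈ A, c β, by
    rw [signomial_sum]; exact Finset.sum_congr rfl fun β hβ => (hc β hβ).1⟩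

/-- The cone is pointed: signomials are determined by their values on `[0, ∞)`. -/
lemma eq_zero_of_mem_sageCone_of_neg_mem {A : Finset ℝ} {f : ℝ → ℝ}
    (hf : f ∈ sageCone (Set.Ici 0) A) (hf' : -f ∈ sageCone (Set.Ici 0) A) : f = 0 := by
  obtain ⟨c, rfl⟩ := exists_signomial_of_mem_sageCone hf
  have h0 : ∀ a ∈ A, c a = 0 := coeff_eq_zero_of_eqOn_zero fun x hx =>
    le_antisymm (by simpa using nonneg_of_mem_sageCone hf' hx) (nonneg_of_mem_sageCone hf hx)
  ext x
  exact Finset.sum_eq_zero fun a ha => by rw [h0 a ha, zero_mul]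

lemma mem_ageCone_of_coeff_nonneg {A : Finset ℝ} {c : ℝ → ℝ} (X : Set ℝ) (β : ℝ)
    (hc : ∀ a ∈ A, 0 ≤ c a) : signomial A c ∈ ageCone X A β :=
  ⟨c, rfl, fun _ _ => Finset.sum_nonneg fun a ha => mul_nonneg (hc a ha) (Real.exp_pos _).le,
    fun a ha _ => hc a ha⟩

lemma mem_ageCone_of_tangent {A : Finset ℝ} {c : ℝ → ℝ} {β x₀ : ℝ}
    (hc : ∀ a ∈ A, a ≠ β → 0 ≤ c a) (h0 : signomial A c x₀ = 0)
    (hD : ∀ x, 0 ≤ x → 0 ≤ (x - x₀) * signomial A (id * c) x₀) :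
    signomial A c ∈ ageCone (Set.Ici 0) A β :=
  ⟨c, rfl, fun x hx => signomial_nonneg_of_tangent hc h0 (hD x hx), hc⟩

/-! ### Extreme rays of pointed cones -/

lemma isClosed_ray {E : Type*} [AddCommGroup E] [Module ℝ E] [TopologicalSpace E]
    [IsTopologicalAddGroup E] [ContinuousSMul ℝ E] [T2Space E] {v : E} (hv : v ≠ 0) :
    IsClosed (ray v) := by
  have : ray v = (fun t : ℝ => t • v) '' Set.Ici 0 := by
    ext w; simp [ray, eq_comm]
  rw [this]
  exact (isClosedEmbedding_smul_left hv).isClosedMap _ isClosed_Ici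

lemma ray_smul {E : Type*} [AddCommGroup E] [Module ℝ E] (v : E) {s : ℝ} (hs : 0 < s) :
    ray (s • v) = ray v := by
  ext w
  constructor
  · rintro ⟨t, ht, rfl⟩; exact ⟨t * s, by positivity, smul_smul _ _ _⟩
  · rintro ⟨t, ht, rfl⟩
    exact ⟨t / s, by positivity, by rw [smul_smul, div_mul_cancel₀ _ hs.ne']⟩

lemma convex_ray {E : Type*} [AddCommGroup E] [Module ℝ E] (v : E) : Convex ℝ (ray v) := by
  rintro _ ⟨s, hs, rfl⟩ _ ⟨t, ht, rfl⟩ a b ha hb -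
  exact ⟨a * s + b * t, by positivity, by rw [add_smul, smul_smul, smul_smul]⟩

lemma finrank_vectorSpan_ray {E : Type*} [AddCommGroup E] [Module ℝ E] {v : E} (hv : v ≠ 0) :
    Module.finrank ℝ (vectorSpan ℝ (ray v)) = 1 := by
  have : vectorSpan ℝ (ray v) = Submodule.span ℝ {v} := by
    apply le_antisymm
    · rw [vectorSpan_def, Submodule.span_le]
      rintro _ ⟨_, ⟨s, -, rfl⟩, _, ⟨t, -, rfl⟩, rfl⟩
      exact Submodule.mem_span_singleton.2 ⟨s - t, by simp [sub_smul]⟩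
    · rw [Submodule.span_singleton_le_iff_mem]
      have := vsub_mem_vectorSpan ℝ (s := ray v) (p₁ := v) (p₂ := 0)
        ⟨1, zero_le_one, by simp⟩ ⟨0, le_rfl, by simp⟩
      simpa using this
  rw [this, finrank_span_singleton hv]

/-- It suffices to test decompositions `x + y` of the generator up to a scalar of any sign:
pointedness of the cone fixes the sign of the factor `s`. -/
lemma ray_mem_extremeRays {E : Type*} [AddCommGroup E] [Module ℝ E] [TopologicalSpace E]
    [IsTopologicalAddGroup E] [ContinuousSMul ℝ E] [T2Space E] {K : Set E} {v : E}
    (hsmul : ∀ t : ℝ, 0 ≤ t → ∀ x ∈ K, t • x ∈ K) (hpt : ∀ x ∈ K, -x ∈ K → x = 0)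
    (hvK : v ∈ K) (hv : v ≠ 0)
    (h : ∀ x ∈ K, ∀ y ∈ K, ∀ t : ℝ, x + y = t • v → ∃ s : ℝ, x = s • v) :
    ray v ∈ extremeRays K := by
  refine ⟨⟨isClosed_ray hv, convex_ray v, ?_, ?_⟩, finrank_vectorSpan_ray hv⟩
  · rintro _ ⟨t, ht, rfl⟩; exact hsmul t ht v hvK
  · rintro x hx y hy _ ⟨t, ht, rfl⟩ ⟨a, b, ha, hb, -, hab⟩
    obtain ⟨s, hs⟩ := h _ (hsmul a ha.le x hx) _ (hsmul b hb.le y hy) t hab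
    have hxs : x = (a⁻¹ * s) • v := by rw [mul_smul, ← hs, smul_smul, inv_mul_cancel₀ ha.ne',
      one_smul]
    rcases le_or_gt 0 (a⁻¹ * s) with h0 | h0
    · exact ⟨_, h0, hxs⟩
    · refine ⟨0, le_rfl, ?_⟩
      rw [zero_smul]
      refine hpt x hx ?_
      rw [hxs, ← neg_smul]
      exact hsmul _ (by linarith) v hvK

section
variable {E : Type*} [AddCommGroup E] [Module ℝ E] [TopologicalSpace E] {K F : Set E}

/-- A face of a cone is closed under nonnegative scaling: `x` is interior to a segment from `t • x`
to another multiple of `x`. -/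
lemma IsFace.smul_mem (hF : IsFace K F)
    (hsmul : ∀ t : ℝ, 0 ≤ t → ∀ x ∈ K, t • x ∈ K) {t : ℝ} (ht : 0 ≤ t) {x : E} (hx : x ∈ F) :
    t • x ∈ F := by
  have hxK := hF.isExtreme.subset hx
  rcases lt_trichotomy t 1 with h | rfl | h
  · refine hF.isExtreme.left_mem_of_mem_openSegment (hsmul t ht x hxK)
      (hsmul 2 zero_le_two x hxK) hx
      ⟨1 / (2 - t), (1 - t) / (2 - t), div_pos one_pos (by linarith),
        div_pos (by linarith) (by linarith), ?_, ?_⟩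
    · have : 2 - t ≠ 0 := by linarith
      field_simp; ring
    · rw [smul_smul, smul_smul, ← add_smul]
      have : 2 - t ≠ 0 := by linarith
      have : 1 / (2 - t) * t + (1 - t) / (2 - t) * 2 = 1 := by field_simp; ring
      rw [this, one_smul]
  · simpa using hx
  · refine hF.isExtreme.left_mem_of_mem_openSegment (hsmul t ht x hxK)
      (hsmul 0 le_rfl x hxK) hx
      ⟨1 / t, 1 - 1 / t, by positivity, ?_, by ring, ?_⟩
    · rw [sub_pos, div_lt_one (by linarith)]; exact h
    · rw [smul_smul, zero_smul, smul_zero, add_zero, one_div_mul_cancel (by linarith), one_smul]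

lemma IsFace.left_mem_of_add_mem (hF : IsFace K F)
    (hsmul : ∀ t : ℝ, 0 ≤ t → ∀ x ∈ K, t • x ∈ K) {x y : E} (hx : x ∈ K) (hy : y ∈ K)
    (hxy : x + y ∈ F) : x ∈ F :=
  hF.isExtreme.left_mem_of_mem_openSegment hx hy
    (hF.smul_mem hsmul (t := 1 / 2) (by norm_num) hxy)
    ⟨1 / 2, 1 / 2, by norm_num, by norm_num, by norm_num, (smul_add _ _ _).symm⟩

lemma exists_ne_zero_mem_of_mem_extremeRays (hF : F ∈ extremeRays K) : ∃ v ∈ F, v ≠ 0 := by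
  by_contra! h
  have hsub : F ⊆ {0} := fun v hv => h v hv
  have : vectorSpan ℝ F = ⊥ := by
    have := vectorSpan_mono ℝ hsub
    rwa [vectorSpan_singleton, le_bot_iff] at this
  have h1 := hF.2
  rw [this] at h1
  simp at h1

lemma eq_ray_of_mem_extremeRays (hF : F ∈ extremeRays K)
    (hsmul : ∀ t : ℝ, 0 ≤ t → ∀ x ∈ K, t • x ∈ K) (hpt : ∀ x ∈ K, -x ∈ K → x = 0)
    {v : E} (hvF : v ∈ F) (hv : v ≠ 0) : F = ray v := by
  have hF' := hF.1
  have h0 : (0 : E) ∈ F := by simpa using hF'.smul_mem hsmul le_rfl hvF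
  have hmem : ∀ w ∈ F, w ∈ vectorSpan ℝ F := fun w hw => by
    simpa using vsub_mem_vectorSpan ℝ hw h0
  refine Set.Subset.antisymm (fun w hw => ?_) ?_
  · obtain ⟨t, ht⟩ := (finrank_eq_one_iff_of_nonzero' (⟨v, hmem v hvF⟩ : vectorSpan ℝ F)
      (by simpa [Subtype.ext_iff] using hv)).1 hF.2 ⟨w, hmem w hw⟩
    have ht' : t • v = w := by simpa using congrArg Subtype.val ht
    rcases le_or_gt 0 t with h | h
    · exact ⟨t, h, ht'.symm⟩
    · refine ⟨0, le_rfl, ?_⟩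
      rw [zero_smul]
      refine hpt w (hF'.isExtreme.subset hw) ?_
      rw [← ht', ← neg_smul]
      exact hsmul _ (by linarith) v (hF'.isExtreme.subset hvF)
  · rintro _ ⟨t, ht, rfl⟩; exact hF'.smul_mem hsmul ht hvF

end

/-- A generator of an extreme ray is a sum of AGE functions, each of which lies in the ray. -/
lemma exists_mem_ageCone_of_mem_extremeRays {A : Finset ℝ} {F : Set (ℝ → ℝ)}
    (hF : F ∈ extremeRays (sageCone (Set.Ici 0) A)) :
    ∃ β ∈ A, ∃ v ∈ F, v ≠ 0 ∧ v ∈ ageCone (Set.Ici 0) A β := by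
  obtain ⟨v, hvF, hv⟩ := exists_ne_zero_mem_of_mem_extremeRays hF
  obtain ⟨g, hg, hgv⟩ := mem_sageCone.1 (hF.1.isExtreme.subset hvF)
  have : ∃ β ∈ A, g β ≠ 0 := by
    by_contra! h
    exact hv (by rw [← hgv]; exact Finset.sum_eq_zero h)
  obtain ⟨β, hβ, hne⟩ := this
  refine ⟨β, hβ, g β, ?_, hne, hg β hβ⟩
  refine hF.1.left_mem_of_add_mem (fun t ht x hx => smul_mem_sageCone ht hx)
    (ageCone_subset_sageCone hβ (hg β hβ)) (y := ∑ γ ∈ A.erase β, g γ) ?_ ?_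
  · refine mem_sageCone.2 ⟨fun γ => if γ = β then 0 else g γ, fun γ hγ => ?_, ?_⟩
    · dsimp only
      split_ifs
      · exact zero_mem_ageCone _ _ _
      · exact hg γ hγ
    · rw [← Finset.add_sum_erase _ _ hβ, if_pos rfl, zero_add]
      exact Finset.sum_congr rfl fun γ hγ => if_neg (Finset.ne_of_mem_erase hγ)
  · rwa [Finset.add_sum_erase _ _ hβ, hgv]

/-! ### Binomials and circuits -/

/-- `exp (q x) - exp (p x)`, which vanishes at the endpoint `0`. -/
noncomputable def binomial (p q : ℝ) : ℝ → ℝ := fun x => Real.exp (q * x) - Real.exp (p * x)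

/-- Coefficients of `binomial p q`. -/
noncomputable def binomialCoeff (p q : ℝ) : ℝ → ℝ := Pi.single q 1 - Pi.single p 1

/-- The signomial with exponents `p, q, r`, unique up to scaling, that has a double zero
at `x₀`. -/
noncomputable def circuit (p q r x₀ : ℝ) : ℝ → ℝ := fun x =>
  (r - q) * Real.exp (p * (x - x₀)) - (r - p) * Real.exp (q * (x - x₀)) +
    (q - p) * Real.exp (r * (x - x₀))

/-- Coefficients of `circuit p q r x₀`. -/
noncomputable def circuitCoeff (p q r x₀ : ℝ) : ℝ → ℝ :=
  Pi.single p ((r - q) * Real.exp (-(p * x₀))) - Pi.single q ((r - p) * Real.exp (-(q * x₀))) +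
    Pi.single r ((q - p) * Real.exp (-(r * x₀)))

lemma signomial_binomialCoeff {A : Finset ℝ} {p q : ℝ} (hp : p ∈ A) (hq : q ∈ A) :
    signomial A (binomialCoeff p q) = binomial p q := by
  ext x
  rw [binomialCoeff, signomial_sub, Pi.sub_apply, signomial_single hp, signomial_single hq]
  simp [binomial]

lemma signomial_circuitCoeff {A : Finset ℝ} {p q r : ℝ} (hp : p ∈ A) (hq : q ∈ A) (hr : r ∈ A)
    (x₀ : ℝ) : signomial A (circuitCoeff p q r x₀) = circuit p q r x₀ := by
  ext x
  have e : ∀ a : ℝ, Real.exp (-(a * x₀)) * Real.exp (a * x) = Real.exp (a * (x - x₀)) := by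
    intro a; rw [← Real.exp_add]; ring_nf
  rw [circuitCoeff, signomial_add, signomial_sub, Pi.add_apply, Pi.sub_apply, signomial_single hp,
    signomial_single hq, signomial_single hr]
  simp only [circuit, mul_assoc, e]

lemma id_mul_single (p t : ℝ) : id * (Pi.single p t : ℝ → ℝ) = Pi.single p (p * t) := by
  ext x
  rcases eq_or_ne x p with rfl | h
  · simp
  · simp [h]

lemma deriv_binomialCoeff {A : Finset ℝ} {p q : ℝ} (hp : p ∈ A) (hq : q ∈ A) :
    signomial A (id * binomialCoeff p q) 0 = q - p := by
  rw [binomialCoeff, mul_sub, id_mul_single, id_mul_single, signomial_sub, Pi.sub_apply,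
    signomial_single hp, signomial_single hq]
  simp

lemma circuit_self (p q r x₀ : ℝ) : circuit p q r x₀ x₀ = 0 := by
  simp [circuit]

lemma deriv_circuitCoeff {A : Finset ℝ} {p q r : ℝ} (hp : p ∈ A) (hq : q ∈ A) (hr : r ∈ A)
    (x₀ : ℝ) : signomial A (id * circuitCoeff p q r x₀) x₀ = 0 := by
  have e : ∀ a : ℝ, Real.exp (-(a * x₀)) * Real.exp (a * x₀) = 1 := by
    intro a; rw [← Real.exp_add]; simp
  rw [circuitCoeff, mul_add, mul_sub, id_mul_single, id_mul_single, id_mul_single, signomial_add,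
    signomial_sub, Pi.add_apply, Pi.sub_apply, signomial_single hp, signomial_single hq,
    signomial_single hr]
  simp only [mul_assoc, e]; ring

lemma binomial_mem_ageCone {A : Finset ℝ} {p q : ℝ} (hp : p ∈ A) (hq : q ∈ A) (hpq : p < q) :
    binomial p q ∈ ageCone (Set.Ici 0) A p := by
  rw [← signomial_binomialCoeff hp hq]
  refine mem_ageCone_of_tangent (x₀ := 0) (fun a _ hap => ?_) ?_ fun x hx => ?_
  · rcases eq_or_ne a q with rfl | h <;> simp [binomialCoeff, *]
  · rw [signomial_binomialCoeff hp hq]; simp [binomial]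
  · rw [deriv_binomialCoeff hp hq, sub_zero]; exact mul_nonneg hx (by linarith)

lemma circuit_mem_ageCone {A : Finset ℝ} {p q r : ℝ} (hp : p ∈ A) (hq : q ∈ A) (hr : r ∈ A)
    (hpq : p < q) (hqr : q < r) (x₀ : ℝ) : circuit p q r x₀ ∈ ageCone (Set.Ici 0) A q := by
  rw [← signomial_circuitCoeff hp hq hr]
  refine mem_ageCone_of_tangent (x₀ := x₀) (fun a _ haq => ?_) ?_ fun x _ => ?_
  · have h1 : 0 ≤ (r - q) * Real.exp (-(p * x₀)) := mul_nonneg (by linarith) (Real.exp_pos _).le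
    have h2 : 0 ≤ (q - p) * Real.exp (-(r * x₀)) := mul_nonneg (by linarith) (Real.exp_pos _).le
    simp only [circuitCoeff, Pi.add_apply, Pi.sub_apply, Pi.single_apply, if_neg haq, sub_zero]
    split_ifs <;> linarith
  · rw [signomial_circuitCoeff hp hq hr, circuit_self]
  · rw [deriv_circuitCoeff hp hq hr, mul_zero]

/-- A circuit whose left gap contains `q` splits into two finer circuits. -/
lemma circuit_split_left (p q r s x₀ : ℝ) :
    (s - q) • circuit p r s x₀ = (s - p) • circuit q r s x₀ + (s - r) • circuit p q s x₀ := by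
  ext x; simp [circuit]; ring

/-- A circuit whose right gap contains `r` splits into two finer circuits. -/
lemma circuit_split_right (p q r s x₀ : ℝ) :
    (r - p) • circuit p q s x₀ = (s - p) • circuit p q r x₀ + (q - p) • circuit p r s x₀ := by
  ext x; simp [circuit]; ring

/-- A binomial with an exponent `p` below both of its exponents splits off a circuit. -/
lemma binomial_split (p q r : ℝ) :
    (q - p) • binomial q r = circuit p q r 0 + (r - q) • binomial p q := by
  ext x; simp [circuit, binomial]; ring

/-! ### Sums of signomials with controlled extreme coefficients -/

/-- If the leading coefficients, in the order `r`, of all members of a finite family are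
nonnegative, then no cancellation of leading terms can occur: an initial segment of coefficients
that vanishes in the sum vanishes in every member. The order is kept abstract so that it can be
used from below and from above. -/
lemma eq_zero_of_sum_eq_zero_of_leading_nonneg {ι κ : Type*} (r : ι → ι → Prop) [IsStrictOrder ι r]
    {A : Finset ι} {B : Finset κ} {d : κ → ι → ℝ}
    (H : ∀ k ∈ B, ∀ a ∈ A, (∀ b ∈ A, r b a → d k b = 0) → 0 ≤ d k a) {l : ι}
    (hl : ∀ a ∈ A, r a l → ∑ k ∈ B, d k a = 0) :
    ∀ k ∈ B, ∀ a ∈ A, r a l → d k a = 0 := by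
  have hwf : (A : Set ι).WellFoundedOn r := A.finite_toSet.wellFoundedOn
  have main : ∀ a ∈ A, r a l → ∀ k ∈ B, d k a = 0 := by
    intro a ha
    refine hwf.induction (P := fun a => r a l → ∀ k ∈ B, d k a = 0) ha ?_
    intro a ha ih hal
    have hnn : ∀ k ∈ B, 0 ≤ d k a := fun k hk =>
      H k hk a ha fun b hb hba => ih b hb hba (trans_of r hba hal) k hk
    exact (Finset.sum_eq_zero_iff_of_nonneg hnn).1 (hl a ha hal)
  exact fun k hk a ha hal => main a ha hal k hk

lemma eq_zero_of_add_eq_zero_of_leading_nonneg {ι : Type*} (r : ι → ι → Prop) [IsStrictOrder ι r]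
    {A : Finset ι} {c d : ι → ℝ}
    (hc : ∀ a ∈ A, (∀ b ∈ A, r b a → c b = 0) → 0 ≤ c a)
    (hd : ∀ a ∈ A, (∀ b ∈ A, r b a → d b = 0) → 0 ≤ d a) {l : ι}
    (hl : ∀ a ∈ A, r a l → c a + d a = 0) : ∀ a ∈ A, r a l → c a = 0 := by
  refine eq_zero_of_sum_eq_zero_of_leading_nonneg r (B := Finset.univ)
    (d := fun b : Bool => cond b c d) ?_ ?_ true (Finset.mem_univ _)
  · rintro (_ | _) -
    · exact hd
    · exact hc
  · intro a ha hal
    simpa using hl a ha hal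

/-- If a sum of signomials that are nonnegative on `[0, ∞)` has a double zero at `x₀ ≥ 0`, so has
each summand. -/
lemma double_zero_of_sum {κ : Type*} {A : Finset ℝ} {B : Finset κ} {d : κ → ℝ → ℝ} {x₀ : ℝ}
    (hx₀ : 0 ≤ x₀) (hd : ∀ k ∈ B, ∀ x, 0 ≤ x → 0 ≤ signomial A (d k) x)
    (h0 : ∑ k ∈ B, signomial A (d k) x₀ = 0)
    (h1 : ∑ k ∈ B, signomial A (id * d k) x₀ = 0) :
    ∀ k ∈ B, signomial A (d k) x₀ = 0 ∧ signomial A (id * d k) x₀ = 0 := by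
  have hV := (Finset.sum_eq_zero_iff_of_nonneg fun k hk => hd k hk x₀ hx₀).1 h0
  have hD : ∀ k ∈ B, 0 ≤ signomial A (id * d k) x₀ := by
    intro k hk
    have := sub_mul_deriv_nonneg (hasDerivAt_signomial A (d k) x₀) hx₀ (hV k hk) (hd k hk)
      (x := x₀ + 1) (by linarith)
    simpa using this
  exact fun k hk => ⟨hV k hk, (Finset.sum_eq_zero_iff_of_nonneg hD).1 h1 k hk⟩

/-- With at most one negative coefficient and a double zero, a signomial has a nonnegative lowest
coefficient: otherwise there would be a single sign change. -/
lemma lowest_coeff_nonneg_of_double_zero {A : Finset ℝ} {c : ℝ → ℝ} {β x₀ : ℝ}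
    (hc : ∀ a ∈ A, a ≠ β → 0 ≤ c a) (h0 : signomial A c x₀ = 0)
    (h1 : signomial A (id * c) x₀ = 0) {a : ℝ} (ha : a ∈ A)
    (hz : ∀ b ∈ A, b < a → c b = 0) : 0 ≤ c a := by
  by_contra! hneg
  have haβ : a = β := by
    by_contra hne
    exact absurd (hc a ha hne) (not_le.2 hneg)
  subst haβ
  have hsum : ∑ b ∈ A, c b * (b - a) * Real.exp (b * x₀) = 0 := by
    have : ∑ b ∈ A, c b * (b - a) * Real.exp (b * x₀) =
        signomial A (id * c) x₀ - a * signomial A c x₀ := by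
      simp only [signomial, Finset.mul_sum, ← Finset.sum_sub_distrib]
      refine Finset.sum_congr rfl fun b _ => ?_
      simp; ring
    rw [this, h0, h1]; simp
  have hterm : ∀ b ∈ A, 0 ≤ c b * (b - a) * Real.exp (b * x₀) := by
    intro b hb
    rcases lt_trichotomy b a with h | rfl | h
    · simp [hz b hb h]
    · simp
    · have := hc b hb h.ne'
      have := sub_pos.2 h
      positivity
  have hall := (Finset.sum_eq_zero_iff_of_nonneg hterm).1 hsum
  have : signomial A c x₀ = c a * Real.exp (a * x₀) := by
    refine Finset.sum_eq_single_of_mem a ha fun b hb hne => ?_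
    have := hall b hb
    simp only [mul_eq_zero, Real.exp_ne_zero, or_false, sub_eq_zero, hne] at this
    simp [this]
  rw [h0] at this
  have := mul_neg_of_neg_of_pos hneg (Real.exp_pos (a * x₀))
  linarith

lemma lowest_coeff_nonneg_of_mem_sageCone {A : Finset ℝ} {c : ℝ → ℝ} {x₀ : ℝ} (hx₀ : 0 ≤ x₀)
    (hmem : signomial A c ∈ sageCone (Set.Ici 0) A) (h0 : signomial A c x₀ = 0)
    (h1 : signomial A (id * c) x₀ = 0) {a : ℝ} (ha : a ∈ A)
    (hz : ∀ b ∈ A, b < a → c b = 0) : 0 ≤ c a := by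
  obtain ⟨g, hg, hgc⟩ := mem_sageCone.1 hmem
  choose! d hd hdn hdc using hg
  have hsum : signomial A (∑ β ∈ A, d β) = signomial A c := by
    rw [signomial_sum, ← hgc]
    exact Finset.sum_congr rfl fun β hβ => (hd β hβ).symm
  have hcoeff : ∀ b ∈ A, ∑ β ∈ A, d β b = c b := by
    intro b hb
    simpa using signomial_injOn hsum b hb
  have hdz := double_zero_of_sum (A := A) (B := A) (d := d) hx₀
    (fun β hβ x hx => by rw [← hd β hβ]; exact hdn β hβ x hx)
    (by rw [← h0, ← hsum, signomial_sum, Finset.sum_apply])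
    (by
      rw [← h1, ← Finset.sum_apply, ← signomial_sum]
      refine Finset.sum_congr rfl fun b hb => ?_
      simp only [Finset.sum_apply, Pi.mul_apply, ← Finset.mul_sum, hcoeff b hb])
  have H : ∀ β ∈ A, ∀ b ∈ A, (∀ b' ∈ A, b' < b → d β b' = 0) → 0 ≤ d β b :=
    fun β hβ b hb hb' =>
      lowest_coeff_nonneg_of_double_zero (hdc β hβ) (hdz β hβ).1 (hdz β hβ).2 hb hb'
  have hzero := eq_zero_of_sum_eq_zero_of_leading_nonneg (· < ·) H (l := a)
    (fun b hb hba => by rw [hcoeff b hb, hz b hb hba])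
  rw [← hcoeff a ha]
  exact Finset.sum_nonneg fun β hβ => H β hβ a ha (hzero β hβ)

/-! ### The listed rays are extreme -/

lemma exp_mem_extremeRays {A : Finset ℝ} {p : ℝ} (hp : p ∈ A) (hmin : ∀ a ∈ A, p ≤ a) :
    ray (fun x : ℝ => Real.exp (p * x)) ∈ extremeRays (sageCone (Set.Ici 0) A) := by
  have hE : signomial A (Pi.single p 1) = fun x : ℝ => Real.exp (p * x) := by
    ext x; rw [signomial_single hp, one_mul]
  refine ray_mem_extremeRays (fun t ht x hx => smul_mem_sageCone ht hx)
    (fun x => eq_zero_of_mem_sageCone_of_neg_mem) ?_ ?_ ?_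
  · rw [← hE]
    refine ageCone_subset_sageCone hp (mem_ageCone_of_coeff_nonneg _ _ fun a _ => ?_)
    rw [Pi.single_apply]; split_ifs <;> simp
  · intro h
    exact (Real.exp_pos (p * 0)).ne' (congrFun h 0)
  · intro f hf g hg t hfg
    obtain ⟨c, rfl⟩ := exists_signomial_of_mem_sageCone hf
    obtain ⟨d, rfl⟩ := exists_signomial_of_mem_sageCone hg
    rw [← hE, ← signomial_smul, ← signomial_add] at hfg
    have hcd := signomial_injOn hfg
    have hz := eq_zero_of_add_eq_zero_of_leading_nonneg (· > ·) (A := A) (c := c) (d := d) (l := p)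
      (fun a ha h => coeff_nonneg_of_forall_gt_eq_zero
        (fun x hx => nonneg_of_mem_sageCone hf hx) ha h)
      (fun a ha h => coeff_nonneg_of_forall_gt_eq_zero
        (fun x hx => nonneg_of_mem_sageCone hg hx) ha h)
      (fun a ha h => by simpa [(show p < a from h).ne'] using hcd a ha)
    refine ⟨c p, ?_⟩
    ext x
    refine Finset.sum_eq_single_of_mem p hp fun a ha hne => ?_
    rw [hz a ha ((hmin a ha).lt_of_ne' hne), zero_mul]

lemma binomial_mem_extremeRays {A : Finset ℝ} {p q : ℝ} (hp : p ∈ A) (hq : q ∈ A) (hpq : p < q)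
    (hA : ∀ a ∈ A, a = p ∨ q ≤ a) :
    ray (binomial p q) ∈ extremeRays (sageCone (Set.Ici 0) A) := by
  have hE := signomial_binomialCoeff hp hq
  refine ray_mem_extremeRays (fun t ht x hx => smul_mem_sageCone ht hx)
    (fun x => eq_zero_of_mem_sageCone_of_neg_mem)
    (ageCone_subset_sageCone hp (binomial_mem_ageCone hp hq hpq)) ?_ ?_
  · intro h
    have h1 := congrFun h 1
    have h2 := Real.exp_lt_exp.2 hpq
    simp only [binomial, mul_one, Pi.zero_apply] at h1
    linarith
  · intro f hf g hg t hfg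
    have h0 : f 0 = 0 := by
      have h1 := congrFun hfg 0
      simp only [Pi.add_apply, Pi.smul_apply, binomial, mul_zero, sub_self, smul_zero] at h1
      have h2 := nonneg_of_mem_sageCone hf (x := 0) (Set.mem_Ici.2 le_rfl)
      have h3 := nonneg_of_mem_sageCone hg (x := 0) (Set.mem_Ici.2 le_rfl)
      linarith
    obtain ⟨c, rfl⟩ := exists_signomial_of_mem_sageCone hf
    obtain ⟨d, rfl⟩ := exists_signomial_of_mem_sageCone hg
    rw [← hE, ← signomial_smul, ← signomial_add] at hfg
    have hcd := signomial_injOn hfg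
    have hz := eq_zero_of_add_eq_zero_of_leading_nonneg (· > ·) (A := A) (c := c) (d := d) (l := q)
      (fun a ha h => coeff_nonneg_of_forall_gt_eq_zero
        (fun x hx => nonneg_of_mem_sageCone hf hx) ha h)
      (fun a ha h => coeff_nonneg_of_forall_gt_eq_zero
        (fun x hx => nonneg_of_mem_sageCone hg hx) ha h)
      (fun a ha h => by
        have h' : q < a := h
        simpa [binomialCoeff, h'.ne', (hpq.trans h').ne'] using hcd a ha)
    have hsum : ∀ x, signomial A c x = c p * Real.exp (p * x) + c q * Real.exp (q * x) := by
      intro x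
      rw [← Finset.sum_pair hpq.ne (f := fun a => c a * Real.exp (a * x))]
      symm
      refine Finset.sum_subset ?_ fun a ha hne => ?_
      · intro a ha
        simp only [Finset.mem_insert, Finset.mem_singleton] at ha
        rcases ha with rfl | rfl <;> assumption
      · simp only [Finset.mem_insert, Finset.mem_singleton, not_or] at hne
        rw [hz a ha (((hA a ha).resolve_left hne.1).lt_of_ne' hne.2), zero_mul]
    rw [hsum] at h0
    simp only [mul_zero, Real.exp_zero, mul_one] at h0
    refine ⟨c q, ?_⟩
    ext x
    rw [hsum, show c p = -c q by linarith]
    simp [binomial]; ring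

lemma circuit_mem_extremeRays {A : Finset ℝ} {p q r x₀ : ℝ} (hp : p ∈ A) (hq : q ∈ A) (hr : r ∈ A)
    (hpq : p < q) (hqr : q < r) (hA : ∀ a ∈ A, p ≤ a → a ≤ r → a = p ∨ a = q ∨ a = r)
    (hx₀ : 0 ≤ x₀) : ray (circuit p q r x₀) ∈ extremeRays (sageCone (Set.Ici 0) A) := by
  have hE := signomial_circuitCoeff hp hq hr x₀
  refine ray_mem_extremeRays (fun t ht x hx => smul_mem_sageCone ht hx)
    (fun x => eq_zero_of_mem_sageCone_of_neg_mem)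
    (ageCone_subset_sageCone hq (circuit_mem_ageCone hp hq hr hpq hqr x₀)) ?_ ?_
  · intro h
    have h' : signomial A (circuitCoeff p q r x₀) = signomial A 0 := by
      rw [hE, h]; ext; simp [signomial]
    have := signomial_injOn h' p hp
    simp [circuitCoeff, hpq.ne, (hpq.trans hqr).ne, sub_eq_zero, hqr.ne'] at this
  · intro f hf g hg t hfg
    obtain ⟨c, rfl⟩ := exists_signomial_of_mem_sageCone hf
    obtain ⟨d, rfl⟩ := exists_signomial_of_mem_sageCone hg
    rw [← hE, ← signomial_smul, ← signomial_add] at hfg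
    have hcd := signomial_injOn hfg
    have hdz := double_zero_of_sum (A := A) (B := Finset.univ)
      (d := fun b : Bool => cond b c d) hx₀
      (by
        rintro (_ | _) - x hx
        · exact nonneg_of_mem_sageCone hg hx
        · exact nonneg_of_mem_sageCone hf hx)
      (by
        have := congrFun hfg x₀
        rw [signomial_add, signomial_smul, hE] at this
        simpa [circuit_self] using this)
      (by
        have h1 : signomial A (id * (c + d)) = signomial A (id * (t • circuitCoeff p q r x₀)) := by
          ext x
          refine Finset.sum_congr rfl fun a ha => ?_
          rw [Pi.mul_apply, Pi.mul_apply, hcd a ha]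
        have := congrFun h1 x₀
        rw [mul_add, mul_smul_comm, signomial_add, signomial_smul, Pi.smul_apply,
          deriv_circuitCoeff hp hq hr] at this
        simpa using this)
    obtain ⟨hc0, hc1⟩ := hdz true (Finset.mem_univ _)
    obtain ⟨hd0, hd1⟩ := hdz false (Finset.mem_univ _)
    simp only [cond_true, cond_false] at hc0 hc1 hd0 hd1
    have hout : ∀ a, a ≠ p → a ≠ q → a ≠ r → (t • circuitCoeff p q r x₀) a = 0 := by
      intro a h1 h2 h3; simp [circuitCoeff, h1, h2, h3]
    have hhigh := eq_zero_of_add_eq_zero_of_leading_nonneg (· > ·) (A := A) (c := c) (d := d)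
      (l := r)
      (fun a ha h => coeff_nonneg_of_forall_gt_eq_zero
        (fun x hx => nonneg_of_mem_sageCone hf hx) ha h)
      (fun a ha h => coeff_nonneg_of_forall_gt_eq_zero
        (fun x hx => nonneg_of_mem_sageCone hg hx) ha h)
      (fun a ha h => by
        have h' : r < a := h
        exact (hcd a ha).trans
          (hout a ((hpq.trans hqr).trans h').ne' (hqr.trans h').ne' h'.ne'))
    have hlow := eq_zero_of_add_eq_zero_of_leading_nonneg (· < ·) (A := A) (c := c) (d := d)
      (l := p)
      (fun a ha h => lowest_coeff_nonneg_of_mem_sageCone hx₀ hf hc0 hc1 ha h)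
      (fun a ha h => lowest_coeff_nonneg_of_mem_sageCone hx₀ hg hd0 hd1 ha h)
      (fun a ha h => (hcd a ha).trans
          (hout a h.ne (h.trans hpq).ne (h.trans (hpq.trans hqr)).ne))
    have hsum : ∀ u : ℝ → ℝ, ∀ x, signomial A (u * c) x = u p * c p * Real.exp (p * x) +
        (u q * c q * Real.exp (q * x) + u r * c r * Real.exp (r * x)) := by
      intro u x
      rw [← Finset.sum_pair hqr.ne (f := fun a => u a * c a * Real.exp (a * x)),
        ← Finset.sum_insert (f := fun a => u a * c a * Real.exp (a * x))
          (by simp [hpq.ne, (hpq.trans hqr).ne])]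
      symm
      refine Finset.sum_subset ?_ fun a ha hne => ?_
      · intro a ha
        simp only [Finset.mem_insert, Finset.mem_singleton] at ha
        rcases ha with rfl | rfl | rfl <;> assumption
      · simp only [Finset.mem_insert, Finset.mem_singleton, not_or] at hne
        have hca : c a = 0 := by
          by_contra hca
          have h1 : p ≤ a := not_lt.1 fun h => hca (hlow a ha h)
          have h2 : a ≤ r := not_lt.1 fun h => hca (hhigh a ha h)
          rcases hA a ha h1 h2 with h | h | h
          · exact hne.1 h
          · exact hne.2.1 h
          · exact hne.2.2 h
        simp [hca]
    have hone := hsum 1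
    simp only [one_mul, Pi.one_apply] at hone
    rw [hone] at hc0
    rw [hsum] at hc1
    simp only [id] at hc1
    have hrp : r - p ≠ 0 := by linarith
    have hQ : c q * Real.exp (q * x₀) = -(r - p) * (-(c q * Real.exp (q * x₀)) / (r - p)) := by
      field_simp
    set s : ℝ := -(c q * Real.exp (q * x₀)) / (r - p) with hs
    -- The two equations of the double zero determine the outer coefficients from the middle one.
    have hR : c r * Real.exp (r * x₀) = (q - p) * s := by
      have : (r - p) * (c r * Real.exp (r * x₀)) = (r - p) * ((q - p) * s) := by
        linear_combination hc1 - p * hc0 - (q - p) * hQ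
      exact mul_left_cancel₀ hrp this
    have hP : c p * Real.exp (p * x₀) = (r - q) * s := by
      linear_combination hc0 - hQ - hR
    have e : ∀ a x : ℝ, Real.exp (a * x) = Real.exp (a * x₀) * Real.exp (a * (x - x₀)) := by
      intro a x; rw [← Real.exp_add]; ring_nf
    refine ⟨s, ?_⟩
    ext x
    rw [hone, e p x, e q x, e r x]
    simp only [circuit, Pi.smul_apply, smul_eq_mul]
    linear_combination Real.exp (p * (x - x₀)) * hP + Real.exp (q * (x - x₀)) * hQ +
      Real.exp (r * (x - x₀)) * hR

/-! ### There are no other extreme rays -/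

/-- Coefficient-wise form of membership of one signomial in the ray of another. -/
lemma coeff_eq_of_mem_ray {A : Finset ℝ} {c d : ℝ → ℝ}
    (h : signomial A d ∈ ray (signomial A c)) : ∃ t, 0 ≤ t ∧ ∀ a ∈ A, d a = t * c a := by
  obtain ⟨t, ht, h⟩ := h
  rw [← signomial_smul] at h
  exact ⟨t, ht, signomial_injOn h⟩

/-- The classification for an arbitrary finite set of exponents, with the circuits parametrized by
the position of their double zero. -/
lemma exists_of_mem_extremeRays {A : Finset ℝ} {F : Set (ℝ → ℝ)}
    (hF : F ∈ extremeRays (sageCone (Set.Ici 0) A)) :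
    (∃ p ∈ A, (∀ a ∈ A, p ≤ a) ∧ F = ray (fun x : ℝ => Real.exp (p * x))) ∨
    (∃ p ∈ A, ∃ q ∈ A, p < q ∧ (∀ a ∈ A, a = p ∨ q ≤ a) ∧ F = ray (binomial p q)) ∨
    (∃ p ∈ A, ∃ q ∈ A, ∃ r ∈ A, p < q ∧ q < r ∧ (∀ a ∈ A, p ≤ a → a ≤ r → a = p ∨ a = q ∨ a = r) ∧
      ∃ x₀ : ℝ, 0 ≤ x₀ ∧ F = ray (circuit p q r x₀)) := by
  have hsmul : ∀ t : ℝ, 0 ≤ t → ∀ x ∈ sageCone (Set.Ici 0) A, t • x ∈ sageCone (Set.Ici 0) A :=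
    fun t ht x hx => smul_mem_sageCone ht hx
  have hray : ∀ v ∈ F, v ≠ 0 → F = ray v := fun v hv hv0 =>
    eq_ray_of_mem_extremeRays hF hsmul (fun x => eq_zero_of_mem_sageCone_of_neg_mem) hv hv0
  have hsplit : ∀ f ∈ sageCone (Set.Ici 0) A, ∀ g ∈ sageCone (Set.Ici 0) A, f + g ∈ F → f ∈ F :=
    fun f hf g hg => hF.1.left_mem_of_add_mem hsmul hf hg
  have hsmulF : ∀ t : ℝ, 0 ≤ t → ∀ v ∈ F, t • v ∈ F := fun t ht v hv =>
    hF.1.smul_mem hsmul ht hv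
  obtain ⟨β, hβ, v, hvF, hv0, c, rfl, hnn, hc⟩ := exists_mem_ageCone_of_mem_extremeRays hF
  -- Every summand that can be split off within the cone spans the same ray.
  have hpeel : ∀ d : ℝ → ℝ, signomial A d ∈ sageCone (Set.Ici 0) A →
      signomial A (c - d) ∈ sageCone (Set.Ici 0) A → signomial A d ∈ F := by
    intro d hd hcd
    refine hsplit _ hd _ hcd ?_
    rwa [← signomial_add, add_sub_cancel]
  by_cases hall : ∀ a ∈ A, 0 ≤ c a
  · left
    have hex : ∃ p ∈ A, 0 < c p := by
      by_contra! h
      refine hv0 ?_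
      ext x
      exact Finset.sum_eq_zero fun a ha => by rw [le_antisymm (h a ha) (hall a ha), zero_mul]
    obtain ⟨p, hp, hcp⟩ := hex
    have hE : signomial A (Pi.single p 1) = fun x : ℝ => Real.exp (p * x) := by
      ext x; rw [signomial_single hp, one_mul]
    have hpF : signomial A (Pi.single p (c p)) ∈ F := by
      refine hpeel _ (ageCone_subset_sageCone hβ (mem_ageCone_of_coeff_nonneg _ _ fun a ha => ?_))
        (ageCone_subset_sageCone hβ (mem_ageCone_of_coeff_nonneg _ _ fun a ha => ?_))
      · rw [Pi.single_apply]; split_ifs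
        · exact hcp.le
        · exact le_rfl
      · rcases eq_or_ne a p with rfl | hne
        · simp
        · simpa [hne] using hall a ha
    have hEF : signomial A (Pi.single p 1) ∈ F := by
      have := hsmulF (c p)⁻¹ (by positivity) _ hpF
      rwa [← signomial_smul, ← Pi.single_smul, smul_eq_mul, inv_mul_cancel₀ hcp.ne'] at this
    have hE0 : signomial A (Pi.single p 1) ≠ 0 := by
      intro h
      rw [hE] at h
      exact (Real.exp_pos (p * 0)).ne' (congrFun h 0)
    refine ⟨p, hp, fun a ha => ?_, by rw [← hE]; exact hray _ hEF hE0⟩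
    by_contra! hap
    have hbin : signomial A (binomialCoeff a p) ∈ F := by
      refine hsplit _ ?_ (signomial A (Pi.single a 1)) ?_ ?_
      · rw [signomial_binomialCoeff ha hp]
        exact ageCone_subset_sageCone ha (binomial_mem_ageCone ha hp hap)
      · refine ageCone_subset_sageCone ha (mem_ageCone_of_coeff_nonneg _ _ fun b _ => ?_)
        rw [Pi.single_apply]; split_ifs <;> simp
      · rwa [← signomial_add, binomialCoeff, sub_add_cancel]
    rw [hray _ hEF hE0] at hbin
    obtain ⟨t, -, ht⟩ := coeff_eq_of_mem_ray hbin
    have := ht a ha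
    simp [binomialCoeff, hap.ne] at this
  · right
    have hcβ : c β < 0 := by
      by_contra! h
      refine hall fun a ha => ?_
      rcases eq_or_ne a β with rfl | hne
      · exact h
      · exact hc a ha hne
    obtain ⟨b, hb, hβb, hcb⟩ : ∃ b ∈ A, β < b ∧ 0 < c b := by
      by_contra! h
      exact absurd (coeff_nonneg_of_forall_gt_eq_zero hnn hβ fun b hb hβb =>
        le_antisymm (h b hb hβb) (hc b hb hβb.ne')) (not_le.2 hcβ)
    have hzero : ∃ x₀, 0 ≤ x₀ ∧ signomial A c x₀ = 0 := by
      by_contra! h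
      obtain ⟨ε, hε, hle⟩ := exists_mul_exp_le_signomial hc hβ hb hβb hcb
        fun x hx => (hnn x hx).lt_of_ne' (h x hx)
      have hmem : signomial A (Pi.single β ε) ∈ F := by
        refine hpeel _
          (ageCone_subset_sageCone hβ (mem_ageCone_of_coeff_nonneg _ _ fun a ha => ?_))
          (ageCone_subset_sageCone hβ ⟨_, rfl, fun x hx => ?_, fun a ha hne => ?_⟩)
        · rw [Pi.single_apply]; split_ifs
          · exact hε.le
          · exact le_rfl
        · rw [signomial_sub, Pi.sub_apply, signomial_single hβ]
          linarith [hle x hx]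
        · simpa [hne] using hc a ha hne
      rw [hray _ hvF hv0] at hmem
      obtain ⟨t, ht, h⟩ := coeff_eq_of_mem_ray hmem
      have := h β hβ
      rw [Pi.single_eq_same] at this
      nlinarith
    obtain ⟨x₀, hx₀, hV⟩ := hzero
    have hder := hasDerivAt_signomial A c x₀
    have hD : ∀ x, 0 ≤ x → 0 ≤ (x - x₀) * signomial A (id * c) x₀ := fun x hx =>
      sub_mul_deriv_nonneg hder hx₀ hV hnn hx
    have hD0 : 0 ≤ signomial A (id * c) x₀ := by simpa using hD (x₀ + 1) (by linarith)
    rcases hD0.lt_or_eq with hDpos | hDzero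
    · left
      -- A zero with positive slope sits at the endpoint, and a binomial can be split off.
      have hx00 : x₀ = 0 := by
        have := hD 0 le_rfl
        nlinarith
      subst hx00
      set ε : ℝ := min (c b) (signomial A (id * c) 0 / (b - β)) with hε
      have hbβ : 0 < b - β := sub_pos.2 hβb
      have hεpos : 0 < ε := lt_min hcb (div_pos hDpos hbβ)
      have hεc : ε ≤ c b := min_le_left _ _
      have hεD : ε * (b - β) ≤ signomial A (id * c) 0 := by
        rw [← le_div_iff₀ hbβ]; exact min_le_right _ _
      have hEF : signomial A (ε • binomialCoeff β b) ∈ F := by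
        refine hpeel _ ?_ (ageCone_subset_sageCone hβ (mem_ageCone_of_tangent (x₀ := 0)
          (fun a ha hne => ?_) ?_ fun x hx => ?_))
        · rw [signomial_smul, signomial_binomialCoeff hβ hb]
          exact hsmul _ hεpos.le _
            (ageCone_subset_sageCone hβ (binomial_mem_ageCone hβ hb hβb))
        · rcases eq_or_ne a b with rfl | hab
          · simpa [binomialCoeff, hne] using hεc
          · simpa [binomialCoeff, hne, hab] using hc a ha hne
        · rw [signomial_sub, Pi.sub_apply, hV, signomial_smul, signomial_binomialCoeff hβ hb]
          simp [binomial]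
        · rw [mul_sub, mul_smul_comm, signomial_sub, signomial_smul, Pi.sub_apply, Pi.smul_apply,
            deriv_binomialCoeff hβ hb, sub_zero, smul_eq_mul]
          exact mul_nonneg hx (by linarith)
      have hBF : signomial A (binomialCoeff β b) ∈ F := by
        have := hsmulF ε⁻¹ (by positivity) _ hEF
        rwa [signomial_smul, smul_smul, inv_mul_cancel₀ hεpos.ne', one_smul] at this
      have hB0 : signomial A (binomialCoeff β b) ≠ 0 := by
        intro h
        have h' : signomial A (binomialCoeff β b) = signomial A 0 := by
          rw [h]; ext; simp [signomial]
        have := signomial_injOn h' b hb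
        simp [binomialCoeff, hβb.ne'] at this
      have hFB := hray _ hBF hB0
      refine ⟨β, hβ, b, hb, hβb, fun γ hγ => ?_, by rwa [signomial_binomialCoeff hβ hb] at hFB⟩
      by_contra! h
      obtain ⟨hne, hγb⟩ := h
      rcases hne.lt_or_gt with hγβ | hβγ
      · have hmem : signomial A (circuitCoeff γ β b 0) ∈ F := by
          rw [signomial_circuitCoeff hγ hβ hb]
          refine hsplit _ (ageCone_subset_sageCone hβ (circuit_mem_ageCone hγ hβ hb hγβ hβb 0))
            ((b - β) • binomial γ β) (hsmul _ hbβ.le _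
              (ageCone_subset_sageCone hγ (binomial_mem_ageCone hγ hβ hγβ))) ?_
          rw [← binomial_split, ← signomial_binomialCoeff hβ hb]
          exact hsmulF _ (by linarith) _ hBF
        rw [hFB] at hmem
        obtain ⟨t, -, ht⟩ := coeff_eq_of_mem_ray hmem
        have := ht γ hγ
        simp [circuitCoeff, binomialCoeff, hγβ.ne, hγb.ne, hbβ.ne'] at this
      · have hmem : signomial A (binomialCoeff β γ) ∈ F := by
          refine hsplit _ ?_ (signomial A (binomialCoeff γ b)) ?_ ?_
          · rw [signomial_binomialCoeff hβ hγ]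
            exact ageCone_subset_sageCone hβ (binomial_mem_ageCone hβ hγ hβγ)
          · rw [signomial_binomialCoeff hγ hb]
            exact ageCone_subset_sageCone hγ (binomial_mem_ageCone hγ hb hγb)
          · rw [← signomial_add]
            convert hBF using 2
            simp [binomialCoeff]
        rw [hFB] at hmem
        obtain ⟨t, -, ht⟩ := coeff_eq_of_mem_ray hmem
        have := ht γ hγ
        simp [binomialCoeff, hβγ.ne', hγb.ne] at this
    · right
      -- At a double zero the weights `c a * exp (a * x₀)` have barycentre `β`, so exponents occur
      -- on both sides of `β`.
      obtain ⟨a, ha, haβ, hca⟩ : ∃ a ∈ A, a < β ∧ 0 < c a := by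
        by_contra! h
        have hsum : ∑ a ∈ A, c a * (a - β) * Real.exp (a * x₀) = 0 := by
          have : ∑ a ∈ A, c a * (a - β) * Real.exp (a * x₀) =
              signomial A (id * c) x₀ - β * signomial A c x₀ := by
            simp only [signomial, Finset.mul_sum, ← Finset.sum_sub_distrib]
            refine Finset.sum_congr rfl fun b _ => ?_
            simp; ring
          rw [this, hV, ← hDzero]; simp
        have hterm : ∀ a ∈ A, 0 ≤ c a * (a - β) * Real.exp (a * x₀) := by
          intro a ha
          rcases lt_trichotomy a β with h' | rfl | h'
          · rw [le_antisymm (h a ha h') (hc a ha h'.ne)]; simp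
          · simp
          · have := hc a ha h'.ne'
            have := sub_pos.2 h'
            positivity
        have h0 := (Finset.sum_eq_zero_iff_of_nonneg hterm).1 hsum b hb
        have := sub_pos.2 hβb
        have : 0 < c b * (b - β) * Real.exp (b * x₀) := by positivity
        linarith
      have hβa : 0 < β - a := sub_pos.2 haβ
      have hbβ : 0 < b - β := sub_pos.2 hβb
      have hab := haβ.trans hβb
      set u : ℝ := (b - β) * Real.exp (-(a * x₀)) with hu
      set w : ℝ := (β - a) * Real.exp (-(b * x₀)) with hw
      have hupos : 0 < u := by positivity
      have hwpos : 0 < w := by positivity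
      set ε : ℝ := min (c a / u) (c b / w) with hε
      have hεpos : 0 < ε := lt_min (by positivity) (by positivity)
      have hεa : ε * u ≤ c a := by rw [← le_div_iff₀ hupos]; exact min_le_left _ _
      have hεb : ε * w ≤ c b := by rw [← le_div_iff₀ hwpos]; exact min_le_right _ _
      have hEF : signomial A (ε • circuitCoeff a β b x₀) ∈ F := by
        refine hpeel _ ?_ (ageCone_subset_sageCone hβ (mem_ageCone_of_tangent (x₀ := x₀)
          (fun γ hγ hne => ?_) ?_ fun x hx => ?_))
        · rw [signomial_smul, signomial_circuitCoeff ha hβ hb]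
          exact hsmul _ hεpos.le _
            (ageCone_subset_sageCone hβ (circuit_mem_ageCone ha hβ hb haβ hβb x₀))
        · rcases eq_or_ne γ a with rfl | hγa
          · simpa [circuitCoeff, hne, hab.ne] using hεa
          · rcases eq_or_ne γ b with rfl | hγb
            · simpa [circuitCoeff, hne, hγa] using hεb
            · simpa [circuitCoeff, hne, hγa, hγb] using hc γ hγ hne
        · rw [signomial_sub, Pi.sub_apply, hV, signomial_smul, signomial_circuitCoeff ha hβ hb]
          simp [circuit_self]
        · rw [mul_sub, mul_smul_comm, signomial_sub, signomial_smul, Pi.sub_apply, Pi.smul_apply,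
            deriv_circuitCoeff ha hβ hb, ← hDzero]
          simp
      have hBF : signomial A (circuitCoeff a β b x₀) ∈ F := by
        have := hsmulF ε⁻¹ (by positivity) _ hEF
        rwa [signomial_smul, smul_smul, inv_mul_cancel₀ hεpos.ne', one_smul] at this
      have hB0 : signomial A (circuitCoeff a β b x₀) ≠ 0 := by
        intro h
        have h' : signomial A (circuitCoeff a β b x₀) = signomial A 0 := by
          rw [h]; ext; simp [signomial]
        have := signomial_injOn h' a ha
        simp [circuitCoeff, haβ.ne, hab.ne, hbβ.ne'] at this
      have hFB := hray _ hBF hB0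
      -- A circuit lying in `F` is supported on `a`, `β`, `b`.
      have hsupp : ∀ p ∈ A, ∀ q ∈ A, ∀ r ∈ A, ∀ s : ℝ, 0 < s →
          s • circuit p q r x₀ ∈ F → ∀ γ ∈ A, γ ≠ a → γ ≠ β → γ ≠ b →
          circuitCoeff p q r x₀ γ = 0 := by
        intro p hp q hq r hr s hs hmem γ hγ h1 h2 h3
        rw [hFB, ← signomial_circuitCoeff hp hq hr, ← signomial_smul] at hmem
        obtain ⟨t, -, ht⟩ := coeff_eq_of_mem_ray hmem
        have := ht γ hγ
        rw [show circuitCoeff a β b x₀ γ = 0 by simp [circuitCoeff, h1, h2, h3], mul_zero] at this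
        exact (mul_eq_zero.1 this).resolve_left hs.ne'
      have hcirc : ∀ p ∈ A, ∀ q ∈ A, ∀ r ∈ A, p < q → q < r → ∀ s : ℝ, 0 < s →
          s • circuit p q r x₀ ∈ sageCone (Set.Ici 0) A := fun p hp q hq r hr hpq hqr s hs =>
        hsmul s hs.le _ (ageCone_subset_sageCone hq (circuit_mem_ageCone hp hq hr hpq hqr x₀))
      rw [signomial_circuitCoeff ha hβ hb] at hBF hFB
      refine ⟨a, ha, β, hβ, b, hb, haβ, hβb, fun γ hγ haγ hγb => ?_, x₀, hx₀, hFB⟩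
      by_contra! h
      obtain ⟨h1, h2, h3⟩ := h
      have haγ' := haγ.lt_of_ne' h1
      have hγb' := hγb.lt_of_ne h3
      rcases h2.lt_or_gt with hγβ | hβγ
      · have hmem : (b - a) • circuit γ β b x₀ ∈ F := by
          refine hsplit _ (hcirc _ hγ _ hβ _ hb hγβ hβb _ (by linarith)) _
            (hcirc _ ha _ hγ _ hb haγ' hγb' (b - β) hbβ) ?_
          rw [← circuit_split_left]
          exact hsmulF _ (by linarith) _ hBF
        have := hsupp _ hγ _ hβ _ hb _ (by linarith) hmem γ hγ h1 h2 h3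
        simp [circuitCoeff, h2, h3, hbβ.ne'] at this
      · have hmem : (b - a) • circuit a β γ x₀ ∈ F := by
          refine hsplit _ (hcirc _ ha _ hβ _ hγ haβ hβγ _ (by linarith)) _
            (hcirc _ ha _ hγ _ hb haγ' hγb' (β - a) hβa) ?_
          rw [← circuit_split_right]
          exact hsmulF _ (by linarith) _ hBF
        have := hsupp _ ha _ hβ _ hγ _ (by linarith) hmem γ hγ h1 h2 h3
        simp [circuitCoeff, h1, h2, hβa.ne'] at this

/-! ### Parametrization of circuits by coefficients -/

/-- The coefficient identity behind the parametrization: if the outer coefficients are those of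
`s • circuit p q r x₀`, the weighted geometric mean gives the middle one. -/
lemma weighted_geom_mean_eq {p q r li lr s x₀ : ℝ} (hpq : p < q) (hqr : q < r) (hs : 0 < s)
    (hlr : lr = (q - p) / (r - p)) (hli : li = (r - q) / (r - p)) :
    (s * ((r - q) * Real.exp (-(p * x₀))) / li) ^ li *
      (s * ((q - p) * Real.exp (-(r * x₀))) / lr) ^ lr =
      s * ((r - p) * Real.exp (-(q * x₀))) := by
  have h1 : 0 < r - q := sub_pos.2 hqr
  have h2 : 0 < q - p := sub_pos.2 hpq
  have h3 : 0 < r - p := by linarith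
  have hsum : li + lr = 1 := by rw [hlr, hli]; field_simp; ring
  have hbar : p * li + r * lr = q := by rw [hlr, hli]; field_simp; ring
  have e1 : s * ((r - q) * Real.exp (-(p * x₀))) / li = s * (r - p) * Real.exp (-(p * x₀)) := by
    rw [hli]; field_simp
  have e2 : s * ((q - p) * Real.exp (-(r * x₀))) / lr = s * (r - p) * Real.exp (-(r * x₀)) := by
    rw [hlr]; field_simp
  have hk : 0 < s * (r - p) := by positivity
  rw [e1, e2, Real.mul_rpow hk.le (Real.exp_pos _).le, Real.mul_rpow hk.le (Real.exp_pos _).le,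
    ← Real.exp_mul, ← Real.exp_mul]
  calc _ = (s * (r - p)) ^ li * (s * (r - p)) ^ lr *
        (Real.exp (-(p * x₀) * li) * Real.exp (-(r * x₀) * lr)) := by ring
    _ = s * (r - p) * Real.exp (-(q * x₀)) := by
        rw [← Real.rpow_add hk, hsum, Real.rpow_one, ← Real.exp_add]
        congr 2
        linear_combination -x₀ * hbar
    _ = _ := by ring

/-- Circuits with a double zero in `[0, ∞)` are, up to scaling, the trinomials given by their
coefficients: `exp ((r - p) * x₀)` is the ratio of `cp / cr` to `li / lr`. -/
lemma exists_ray_circuit_iff {p q r : ℝ} (hpq : p < q) (hqr : q < r) (R : Set (ℝ → ℝ)) :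
    (∃ x₀ : ℝ, 0 ≤ x₀ ∧ R = ray (circuit p q r x₀)) ↔
      ∃ li lr cp cq cr : ℝ, lr = (q - p) / (r - p) ∧ li = (r - q) / (r - p) ∧ 0 < cr ∧ 0 < cp ∧
        cq = -((cp / li) ^ li * (cr / lr) ^ lr) ∧ li / lr ≤ cp / cr ∧
        R = ray (fun x : ℝ =>
          cr * Real.exp (r * x) + cq * Real.exp (q * x) + cp * Real.exp (p * x)) := by
  have h1 : 0 < r - q := sub_pos.2 hqr
  have h2 : 0 < q - p := sub_pos.2 hpq
  have h3 : 0 < r - p := by linarith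
  have hfun : ∀ s x₀ : ℝ, (fun x : ℝ => s * ((q - p) * Real.exp (-(r * x₀))) * Real.exp (r * x) +
      -(s * ((r - p) * Real.exp (-(q * x₀)))) * Real.exp (q * x) +
      s * ((r - q) * Real.exp (-(p * x₀))) * Real.exp (p * x)) = s • circuit p q r x₀ := by
    intro s x₀
    ext x
    have e : ∀ a : ℝ, Real.exp (a * (x - x₀)) = Real.exp (-(a * x₀)) * Real.exp (a * x) := by
      intro a; rw [← Real.exp_add]; ring_nf
    simp only [circuit, Pi.smul_apply, smul_eq_mul, e]; ring
  constructor
  · rintro ⟨x₀, hx₀, rfl⟩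
    refine ⟨_, _, 1 * ((r - q) * Real.exp (-(p * x₀))), _,
      1 * ((q - p) * Real.exp (-(r * x₀))), rfl, rfl, by positivity, by positivity, rfl, ?_, ?_⟩
    · have e : Real.exp (-(p * x₀)) = Real.exp ((r - p) * x₀) * Real.exp (-(r * x₀)) := by
        rw [← Real.exp_add]; ring_nf
      have h4 : 1 ≤ Real.exp ((r - p) * x₀) := Real.one_le_exp (by positivity)
      rw [e, div_div_div_cancel_right₀ h3.ne', div_le_div_iff₀ h2 (by positivity)]
      have : 0 < (r - q) * (q - p) * Real.exp (-(r * x₀)) := by positivity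
      nlinarith
    · rw [weighted_geom_mean_eq hpq hqr one_pos rfl rfl, hfun, one_smul]
  · rintro ⟨li, lr, cp, cq, cr, hlr, hli, hcr, hcp, hcq, hle, rfl⟩
    have hli0 : 0 < li := by rw [hli]; positivity
    have hlr0 : 0 < lr := by rw [hlr]; positivity
    set ρ : ℝ := cp / cr / (li / lr) with hρ
    have hρ1 : 1 ≤ ρ := by rw [hρ, le_div_iff₀ (by positivity), one_mul]; exact hle
    have hρ0 : 0 < ρ := by linarith
    set x₀ : ℝ := Real.log ρ / (r - p) with hx₀
    have hexp : Real.exp ((r - p) * x₀) = ρ := by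
      rw [hx₀, mul_div_cancel₀ _ h3.ne', Real.exp_log hρ0]
    set s : ℝ := cr * Real.exp (r * x₀) / (q - p) with hs
    have hs0 : 0 < s := by positivity
    have ecr : cr = s * ((q - p) * Real.exp (-(r * x₀))) := by
      have : Real.exp (r * x₀) * Real.exp (-(r * x₀)) = 1 := by rw [← Real.exp_add]; simp
      rw [hs]; field_simp
      linear_combination -this
    have ecp : cp = s * ((r - q) * Real.exp (-(p * x₀))) := by
      have e : Real.exp (r * x₀) * Real.exp (-(p * x₀)) = ρ := by
        rw [← hexp, ← Real.exp_add]; ring_nf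
      have : s * ((r - q) * Real.exp (-(p * x₀))) = cr * (r - q) / (q - p) * ρ := by
        rw [hs, ← e]; ring
      rw [this, hρ, hli, hlr]; field_simp
    refine ⟨x₀, div_nonneg (Real.log_nonneg hρ1) h3.le, ?_⟩
    have ecq : cq = -(s * ((r - p) * Real.exp (-(q * x₀)))) := by
      rw [hcq, ← weighted_geom_mean_eq hpq hqr hs0 hlr hli, ← ecp, ← ecr]
    rw [← ray_smul (circuit p q r x₀) hs0, ← hfun, ← ecq, ← ecp, ← ecr]

theorem proposition6p1 (m : ℕ) (hm : 0 < m) (α : Fin m → ℝ) (hα : StrictMono α) :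
    extremeRays (sageCone (Set.Ici 0) (Finset.univ.image α)) =
      {ray (fun x : ℝ => Real.exp (α ⟨0, hm⟩ * x))}
      ∪ {R | ∃ h : 1 < m,
          R = ray (fun x : ℝ => Real.exp (α ⟨1, h⟩ * x) - Real.exp (α ⟨0, hm⟩ * x))}
      ∪ {R | ∃ i j k : Fin m, (j : ℕ) = i + 1 ∧ (k : ℕ) = j + 1 ∧
          ∃ li lk ci cj ck : ℝ,
            lk = (α j - α i) / (α k - α i) ∧
            li = (α k - α j) / (α k - α i) ∧
            0 < ck ∧ 0 < ci ∧
            cj = -((ci / li) ^ li * (ck / lk) ^ lk) ∧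
            li / lk ≤ ci / ck ∧
            R = ray (fun x : ℝ =>
              ck * Real.exp (α k * x) + cj * Real.exp (α j * x) + ci * Real.exp (α i * x))} := by
  have hmem : ∀ i, α i ∈ Finset.univ.image α := fun i =>
    Finset.mem_image_of_mem _ (Finset.mem_univ i)
  have hforall : ∀ P : ℝ → Prop, (∀ a ∈ Finset.univ.image α, P a) ↔ ∀ i, P (α i) := by simp
  have hmin : ∀ i, α ⟨0, hm⟩ ≤ α i := fun i => hα.monotone (Fin.mk_le_of_le_val (Nat.zero_le _))
  ext R
  constructor
  · intro hR
    rcases exists_of_mem_extremeRays hR with ⟨p, hp, hpA, rfl⟩ | ⟨p, hp, q, hq, hpq, hA, rfl⟩ |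
      ⟨p, hp, q, hq, r, hr, hpq, hqr, hA, hex⟩
    · left; left
      rw [Set.mem_singleton_iff, le_antisymm (hpA _ (hmem _)) ((hforall _).2 hmin p hp)]
    · left; right
      obtain ⟨i, -, rfl⟩ := Finset.mem_image.1 hp
      obtain ⟨j, -, rfl⟩ := Finset.mem_image.1 hq
      rw [hforall] at hA
      have hij : i < j := hα.lt_iff_lt.1 hpq
      have hcons : ∀ l, l = i ∨ j ≤ l := fun l => by
        simpa [hα.injective.eq_iff, hα.le_iff_le] using hA l
      have h1 : 1 < m := by have := j.2; have : (i : ℕ) < j := hij; omega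
      have hi : i = ⟨0, hm⟩ := by
        rcases hcons ⟨0, hm⟩ with h | h
        · exact h.symm
        · have h' : (j : ℕ) ≤ 0 := h
          have : (i : ℕ) < j := hij
          omega
      have hj : j = ⟨1, h1⟩ := by
        subst hi
        have h0 : 0 < (j : ℕ) := hij
        rcases hcons ⟨1, h1⟩ with h | h
        · simp [Fin.ext_iff] at h
        · have h' : (j : ℕ) ≤ 1 := h
          ext
          change (j : ℕ) = 1
          omega
      refine ⟨h1, ?_⟩
      rw [hi, hj]; rfl
    · right
      rw [exists_ray_circuit_iff hpq hqr] at hex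
      obtain ⟨i, -, rfl⟩ := Finset.mem_image.1 hp
      obtain ⟨j, -, rfl⟩ := Finset.mem_image.1 hq
      obtain ⟨k, -, rfl⟩ := Finset.mem_image.1 hr
      rw [hforall] at hA
      have hij : (i : ℕ) < j := hα.lt_iff_lt.1 hpq
      have hjk : (j : ℕ) < k := hα.lt_iff_lt.1 hqr
      have hcons : ∀ l : ℕ, (i : ℕ) ≤ l → l ≤ k → l = i ∨ l = j ∨ l = k := fun l h1 h2 => by
        have hl : l < m := lt_of_le_of_lt h2 k.2
        have := hA ⟨l, hl⟩ (hα.monotone h1) (hα.monotone h2)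
        simpa [hα.injective.eq_iff, Fin.ext_iff] using this
      refine ⟨i, j, k, ?_, ?_, hex⟩
      · have := hcons (i + 1) (by omega) (by omega); omega
      · have := hcons (j + 1) (by omega) (by omega); omega
  · rintro ((hR | ⟨h1, rfl⟩) | ⟨i, j, k, hij, hjk, hex⟩)
    · rw [Set.mem_singleton_iff.1 hR]
      exact exp_mem_extremeRays (hmem _) ((hforall _).2 hmin)
    · refine binomial_mem_extremeRays (hmem _) (hmem _) (hα (by simp)) ((hforall _).2 fun l => ?_)
      rcases Nat.eq_zero_or_pos (l : ℕ) with h | h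
      · left; congr 1; exact Fin.ext h
      · right; exact hα.monotone h
    · have hpq : α i < α j := hα (show (i : ℕ) < j by omega)
      have hqr : α j < α k := hα (show (j : ℕ) < k by omega)
      rw [← exists_ray_circuit_iff hpq hqr] at hex
      obtain ⟨x₀, hx₀, rfl⟩ := hex
      refine circuit_mem_extremeRays (hmem _) (hmem _) (hmem _) hpq hqr
        ((hforall _).2 fun l h1 h2 => ?_) hx₀
      have h1' : (i : ℕ) ≤ l := hα.le_iff_le.1 h1
      have h2' : (l : ℕ) ≤ k := hα.le_iff_le.1 h2
      simp only [hα.injective.eq_iff, Fin.ext_iff]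
      omega
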